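/- Let $f_0,f_1$ be probability density functions on $\mathbb R$ with $0<\mathbf I(f_1\|f_0)<\infty$ and $0<\mathbf I(f_0\|f_1)<\infty$, where $\mathbf I(f\|g)=\int f\ln(f/g)\,dx$. For each change time $\nu\in\{1,2,\dots\}$ let $\mathbb P_\nu$ (expectation $\mathbb E_\nu$) be a probability measure under which the real observations $X_1,X_2,\dots$ are independent, $X_k$ having density $f_0$ for $k<\nu$ and $f_1$ for $k\ge\nu$. A censoring strategy is a measurable $\psi:\mathbb R\to\{0,1\}$; put $$\ell^{\psi}(\gamma,x)=\gamma\ln\frac{f_1(x)}{f_0(x)}+(1-\gamma)\ln\frac{\int_{\{\psi=0\}}f_1}{\int_{\{\psi=0\}}f_0},\qquad \mathbf I^{\psi}(f_1\|f_0)=\int \ell^{\psi}(\psi(x),x)f_1(x)\,dx,$$ and for $0<e\le 1$ let $\psi^*(e)$ be any maximizer of $\mathbf I^{\psi}(f_1\|f_0)$ among the strategies $\psi$ with $\int_{\{\psi=1\}}f_0=e$. Let $a_1<a$, $a>0$ and $0<\epsilon_1\le1$. The CuSum-AC algorithm starts at $s_0=0$ and, for $k\ge1$, uses the strategy $\psi_k=\psi^*(1)$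 if $s_{k-1}\ge a_1$ and $\psi_k=\psi^*(\epsilon_1)$ if $s_{k-1}<a_1$, sets $\gamma_k=\psi_k(X_k)$ and $\tilde s_k=\max\{0,s_{k-1}+\ell^{\psi_k}(\gamma_k,X_k)\}$, and puts $s_k=a_1$ if $s_{k-1}<a_1\le\tilde s_k$ and $s_k=\tilde s_k$ otherwise. Let $\Psi=(\psi_1,\psi_2,\dots)$, let $T_c(a)=\inf\{k\ge1:s_k\ge a\}$, and let $\mathcal I_k$ be the $\sigma$-algebra generated by $(\gamma_1,\gamma_1X_1),\dots,(\gamma_k,\gamma_kX_k)$ ($\mathcal I_0$ is trivial). For a random time $T$ define Lorden's worst-worst-case delay $$d_L(T,\Psi)=\sup_{1\le\nu<\infty}\operatorname{ess\,sup}\ \mathbb E_\nu\big[(T-\nu+1)^+\mid\mathcal I_{\nu-1}\big],$$ where the essential supremum is with respect to $\mathbb P_\nu$. Then $T_c(a)$ is an equalizer rule: for every $\nu\ge1$, $$d_L(T_c(a),\Psi)=\operatorname{ess\,sup}\ \mathbb E_\nu\big[(T_c(a)-\nu+1)^+\mid\mathcal I_{\nu-1}\big].$$ -/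

import Mathlib

open MeasureTheory ProbabilityTheory
open scoped ENNReal

noncomputable section

namespace CuSumAC

/-! ### Observations -/

/-- `f` is a probability density function on the real line. -/
structure IsPDF (f : ℝ → ℝ) : Prop where
  measurable : Measurable f
  nonneg : ∀ x, 0 ≤ f x
  lintegral_eq_one : ∫⁻ x, ENNReal.ofReal (f x) = 1

/-- The law on the real line with density `f`. -/
def densityLaw (f : ℝ → ℝ) : Measure ℝ :=
  volume.withDensity fun x => ENNReal.ofReal (f x)

/-- Under `P ν` the observations `X 1, X 2, …` are independent, those before the change time `ν`
have density `f₀`, and those from `ν` on have density `f₁`. -/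
structure IsChangePointModel {Ω : Type*} [MeasurableSpace Ω] (f₀ f₁ : ℝ → ℝ)
    (X : ℕ+ → Ω → ℝ) (P : ℕ+ → Measure Ω) : Prop where
  measurable : ∀ k, Measurable (X k)
  indep : ∀ ν, iIndepFun X (P ν)
  law_pre : ∀ ν k, k < ν → (P ν).map (X k) = densityLaw f₀
  law_post : ∀ ν k, ν ≤ k → (P ν).map (X k) = densityLaw f₁

/-! ### Censoring

A censoring strategy is a function `ψ : ℝ → Bool`; the observation `x` is sent (`γ = 1`) when
`ψ x = true`. -/

/-- The log-likelihood ratio of what the decision maker receives when the strategy `ψ` is in use: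
that of the observation itself if it is sent, that of the event "nothing is sent" otherwise. -/
def censoredLLR (f₀ f₁ : ℝ → ℝ) (ψ : ℝ → Bool) (γ : Bool) (x : ℝ) : ℝ :=
  if γ = true then Real.log (f₁ x / f₀ x)
  else Real.log ((densityLaw f₁).real {y | ψ y = false} / (densityLaw f₀).real {y | ψ y = false})

/-- The post-censoring Kullback-Leibler divergence. -/
def censoredKL (f₀ f₁ : ℝ → ℝ) (ψ : ℝ → Bool) : ℝ :=
  ∫ x, censoredLLR f₀ f₁ ψ (ψ x) x ∂(densityLaw f₁)

/-- The censoring strategies with pre-change communication rate `e`. -/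
def censoringClass (f₀ : ℝ → ℝ) (e : ℝ) : Set (ℝ → Bool) :=
  {ψ | Measurable ψ ∧ densityLaw f₀ {x | ψ x = true} = ENNReal.ofReal e}

/-- `ψ` attains the maximum of the post-censoring divergence among the strategies with
pre-change communication rate `e`. -/
def IsOptimalCensoring (f₀ f₁ : ℝ → ℝ) (e : ℝ) (ψ : ℝ → Bool) : Prop :=
  ψ ∈ censoringClass f₀ e ∧ IsMaxOn (censoredKL f₀ f₁) (censoringClass f₀ e) ψ

/-! ### Information pattern and Lorden's delay

`X` is the sequence of observations and `Ψ k ω` is the censoring strategy in use at time `k`. -/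

section Delay

variable {Ω : Type*}

/-- The indicator `γ k` of the event that the `k`-th observation is sent. -/
def sent (X : ℕ+ → Ω → ℝ) (Ψ : ℕ+ → Ω → ℝ → Bool) (k : ℕ+) (ω : Ω) : Bool :=
  Ψ k ω (X k ω)

/-- The product `γ k * X k`. -/
def received (X : ℕ+ → Ω → ℝ) (Ψ : ℕ+ → Ω → ℝ → Bool) (k : ℕ+) (ω : Ω) : ℝ :=
  if sent X Ψ k ω = true then X k ω else 0

/-- The σ-algebra generated by the information `(γ j, γ j * X j)`, `1 ≤ j ≤ n`; it is trivial
for `n = 0`. -/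
abbrev infoSigma (X : ℕ+ → Ω → ℝ) (Ψ : ℕ+ → Ω → ℝ → Bool) (n : ℕ) : MeasurableSpace Ω :=
  ⨆ (j : ℕ+) (_ : (j : ℕ) ≤ n),
    MeasurableSpace.comap (fun ω => (sent X Ψ j ω, received X Ψ j ω)) inferInstance

/-- The worst conditional delay at the change time `ν`: the essential supremum, under `P ν`, of
the conditional expectation of `(T - ν + 1)⁺` given the information up to time `ν - 1`.
(Subtraction in `ℕ∞` is truncated at `0`, and `⊤ + 1 - ν = ⊤`.) -/
def worstDelayAt [MeasurableSpace Ω] (P : ℕ+ → Measure Ω) (X : ℕ+ → Ω → ℝ)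
    (Ψ : ℕ+ → Ω → ℝ → Bool) (T : Ω → ℕ∞) (ν : ℕ+) : ℝ≥0∞ :=
  essSup (condLExp (infoSigma X Ψ ((ν : ℕ) - 1)) (P ν)
    fun ω => ((T ω + 1 - ((ν : ℕ) : ℕ∞) : ℕ∞) : ℝ≥0∞)) (P ν)

/-- Lorden's worst-worst-case detection delay. -/
def lordenDelay [MeasurableSpace Ω] (P : ℕ+ → Measure Ω) (X : ℕ+ → Ω → ℝ)
    (Ψ : ℕ+ → Ω → ℝ → Bool) (T : Ω → ℕ∞) : ℝ≥0∞ :=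
  ⨆ ν : ℕ+, worstDelayAt P X Ψ T ν

end Delay

/-! ### The CuSum-AC algorithm

`ψhi` is the strategy used when the statistic is at least the switching threshold `a₁`, and `ψlo`
the one used when it is below `a₁`. -/

/-- The censoring strategy chosen when the previous value of the statistic is `s`. -/
def strategyAt (ψhi ψlo : ℝ → Bool) (a₁ s : ℝ) : ℝ → Bool :=
  if a₁ ≤ s then ψhi else ψlo

/-- The update of the statistic before the reset. -/
def preStep (f₀ f₁ : ℝ → ℝ) (ψhi ψlo : ℝ → Bool) (a₁ s x : ℝ) : ℝ :=
  max 0 (s + censoredLLR f₀ f₁ (strategyAt ψhi ψlo a₁ s) (strategyAt ψhi ψlo a₁ s x) x)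

/-- The update of the statistic: it is reset to `a₁` when it crosses `a₁` from below. -/
def step (f₀ f₁ : ℝ → ℝ) (ψhi ψlo : ℝ → Bool) (a₁ s x : ℝ) : ℝ :=
  if s < a₁ ∧ a₁ ≤ preStep f₀ f₁ ψhi ψlo a₁ s x then a₁
  else preStep f₀ f₁ ψhi ψlo a₁ s x

/-- The CuSum-AC statistic at time `n` along the observation path `x`, started at `0`. -/
def statistic (f₀ f₁ : ℝ → ℝ) (ψhi ψlo : ℝ → Bool) (a₁ : ℝ) (x : ℕ+ → ℝ) : ℕ → ℝ
  | 0 => 0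
  | n + 1 => step f₀ f₁ ψhi ψlo a₁ (statistic f₀ f₁ ψhi ψlo a₁ x n) (x n.succPNat)

/-- The adaptive censoring policy of the CuSum-AC algorithm: the strategy in use at time `k`. -/
def policy (f₀ f₁ : ℝ → ℝ) (ψhi ψlo : ℝ → Bool) (a₁ : ℝ) (x : ℕ+ → ℝ) (k : ℕ+) : ℝ → Bool :=
  strategyAt ψhi ψlo a₁ (statistic f₀ f₁ ψhi ψlo a₁ x ((k : ℕ) - 1))

/-- The CuSum-AC stopping time: the first time `k ≥ 1` at which the statistic is at least `a`
(infinite if there is none). -/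
def stoppingTime (f₀ f₁ : ℝ → ℝ) (ψhi ψlo : ℝ → Bool) (a₁ a : ℝ) (x : ℕ+ → ℝ) : ℕ∞ :=
  ⨅ (k : ℕ+) (_ : a ≤ statistic f₀ f₁ ψhi ψlo a₁ x k), ((k : ℕ) : ℕ∞)

end CuSumAC

end

/-! Before the alarm, the statistic is a Markov recursion computable from the received information.
Let `g s` be the mean exit time above `a` of this recursion started at `s` and driven by `f₁`. Then
the conditional delay at `ν` is `g (s_{ν-1})` if no alarm has occurred by time `ν - 1`, and `0`
otherwise (`condLExp_residual_exit`). Its essential supremum is `g 0` for every `ν`, for two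
reasons.

Upper bound: the statistic is nonnegative and `g` is antitone (`antitone_truncatedExit`).
Monotonicity within each regime is clear because the strategy is fixed there. Across `a₁` the
strategies differ, and the reset saves the argument: a path from below spends at least one step and
lands no higher than `a₁`.

Attainment: the censored log-likelihood ratio is nonpositive with positive `f₀`-probability
(`densityLaw_censoredLLR_nonpos_pos`). By independence the statistic therefore stays at `0` up to
time `ν - 1` with positive probability. -/

namespace CuSumAC

/-! ### The expected truncated exit time of a one-dimensional recursion -/

/-- The expectation of the minimum of `n` and the exit time from `(-∞, a)` of the recursion
`s ↦ F s x` driven by independent inputs `x` of law `μ`, as a function of the initial state. -/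
noncomputable def truncatedExit (F : ℝ → ℝ → ℝ) (a : ℝ) (μ : Measure ℝ) : ℕ → ℝ → ℝ≥0∞
  | 0, _ => 0
  | n + 1, s => if s < a then 1 + ∫⁻ x, truncatedExit F a μ n (F s x) ∂μ else 0

theorem truncatedExit_of_le {F : ℝ → ℝ → ℝ} {a : ℝ} {μ : Measure ℝ} {s : ℝ} (h : a ≤ s) (n : ℕ) :
    truncatedExit F a μ n s = 0 := by
  cases n <;> simp [truncatedExit, h.not_gt]

theorem truncatedExit_le_succ (F : ℝ → ℝ → ℝ) (a : ℝ) (μ : Measure ℝ) (n : ℕ) (s : ℝ) :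
    truncatedExit F a μ n s ≤ truncatedExit F a μ (n + 1) s := by
  induction n generalizing s with
  | zero => simp [truncatedExit]
  | succ n ih =>
    rw [truncatedExit, truncatedExit]
    split_ifs
    · gcongr
      exact ih _
    · exact le_rfl

/-- One more unit of horizon adds at most one unit of time. This pays for the step spent crossing
`a₁` in `antitone_truncatedExit`. -/
theorem truncatedExit_succ_le (F : ℝ → ℝ → ℝ) (a : ℝ) (μ : Measure ℝ) [IsProbabilityMeasure μ]
    (n : ℕ) (s : ℝ) : truncatedExit F a μ (n + 1) s ≤ 1 + truncatedExit F a μ n s := by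
  induction n generalizing s with
  | zero =>
    by_cases h : s < a <;> simp [truncatedExit, h]
  | succ n ih =>
    rw [truncatedExit]
    split_ifs with h
    · rw [truncatedExit, if_pos h]
      gcongr
      calc ∫⁻ x, truncatedExit F a μ (n + 1) (F s x) ∂μ
          ≤ ∫⁻ x, (1 + truncatedExit F a μ n (F s x)) ∂μ := lintegral_mono fun x => ih _
        _ = 1 + ∫⁻ x, truncatedExit F a μ n (F s x) ∂μ := by
          rw [lintegral_add_left measurable_const]; simp
    · exact zero_le

theorem antitone_truncatedExit {F : ℝ → ℝ → ℝ} {a a₁ : ℝ} {μ : Measure ℝ}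
    [IsProbabilityMeasure μ] (ha₁ : a₁ < a)
    (hlow : ∀ ⦃s t : ℝ⦄, s ≤ t → t < a₁ → ∀ x, F s x ≤ F t x)
    (hhigh : ∀ ⦃s t : ℝ⦄, a₁ ≤ s → s ≤ t → ∀ x, F s x ≤ F t x)
    (hcap : ∀ ⦃s : ℝ⦄, s < a₁ → ∀ x, F s x ≤ a₁) (n : ℕ) :
    Antitone (truncatedExit F a μ n) := by
  induction n with
  | zero => intro s t _; simp [truncatedExit]
  | succ n ih =>
    have same : ∀ {s t : ℝ}, s ≤ t → (∀ x, F s x ≤ F t x) →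
        truncatedExit F a μ (n + 1) t ≤ truncatedExit F a μ (n + 1) s := by
      intro s t hst h
      rw [truncatedExit, truncatedExit]
      split_ifs with ht hs
      · gcongr
        exact ih (h _)
      · exact absurd (hst.trans_lt ht) hs
      · exact zero_le
      · exact le_rfl
    intro s t hst
    rcases lt_or_ge t a₁ with ht | ht
    · exact same hst (hlow hst ht)
    rcases le_or_gt a₁ s with hs | hs
    · exact same hst (hhigh hs hst)
    -- Here `s < a₁ ≤ t`, and `F s` and `F t` are not comparable. Both sides are compared with `a₁`:
    -- the step from `s` costs one and ends at or below `a₁`, where the induction hypothesis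
    -- applies.
    calc truncatedExit F a μ (n + 1) t ≤ truncatedExit F a μ (n + 1) a₁ :=
          same ht (hhigh le_rfl ht)
      _ ≤ 1 + truncatedExit F a μ n a₁ := truncatedExit_succ_le F a μ n a₁
      _ = 1 + ∫⁻ _, truncatedExit F a μ n a₁ ∂μ := by simp
      _ ≤ 1 + ∫⁻ x, truncatedExit F a μ n (F s x) ∂μ := by
          gcongr with x
          exact ih (hcap hs x)
      _ = truncatedExit F a μ (n + 1) s := by
          rw [truncatedExit, if_pos (hs.trans ha₁)]

theorem measurable_truncatedExit {F : ℝ → ℝ → ℝ} (hF : Measurable (Function.uncurry F)) (a : ℝ)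
    (μ : Measure ℝ) [IsProbabilityMeasure μ] (n : ℕ) : Measurable (truncatedExit F a μ n) := by
  induction n with
  | zero => exact measurable_const
  | succ n ih =>
    refine Measurable.ite measurableSet_Iio (Measurable.const_add ?_ 1) measurable_const
    exact (ih.comp hF).lintegral_prod_right'

/-! ### Recursions driven by independent inputs -/

section Chain

variable {Ω : Type*}

/-- An independent input can be integrated out. -/
theorem setLIntegral_comp_of_indep {m mΩ : MeasurableSpace Ω} {P : Measure Ω}
    [IsProbabilityMeasure P] (hm : m ≤ mΩ) {Y Z : Ω → ℝ} (hY : Measurable[m] Y) (hZ : Measurable Z)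
    (hind : Indep m (MeasurableSpace.comap Z inferInstance) P) {H : ℝ → ℝ → ℝ≥0∞}
    (hH : Measurable (Function.uncurry H)) {A : Set Ω} (hA : MeasurableSet[m] A) :
    ∫⁻ ω in A, H (Y ω) (Z ω) ∂P = ∫⁻ ω in A, ∫⁻ x, H (Y ω) x ∂(P.map Z) ∂P := by
  have hmZ : IsProbabilityMeasure (P.map Z) := Measure.isProbabilityMeasure_map hZ.aemeasurable
  -- Carrying the indicator of `A` along with `Y` turns the set integral into the integral of a
  -- function of `(W, Z)`, whose law is a product.
  let W : Ω → ℝ × ℝ≥0∞ := fun ω => (Y ω, A.indicator 1 ω)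
  have hWm : Measurable[m] W :=
    hY.prodMk (Measurable.indicator (m := m) measurable_const hA)
  have hW : Measurable W := hWm.mono hm le_rfl
  have hWZ : IndepFun W Z P := by
    rw [IndepFun_iff_Indep]
    exact indep_of_indep_of_le_left hind hWm.comap_le
  have hmap := hWZ.map_prod_eq_prod_map_map hW.aemeasurable hZ.aemeasurable
  let K : (ℝ × ℝ≥0∞) × ℝ → ℝ≥0∞ := fun p => p.1.2 * H p.1.1 p.2
  have hK : Measurable K := by
    have : Measurable fun p : (ℝ × ℝ≥0∞) × ℝ => H p.1.1 p.2 :=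
      hH.comp (f := fun p : (ℝ × ℝ≥0∞) × ℝ => (p.1.1, p.2)) (by fun_prop)
    exact (by fun_prop : Measurable fun p : (ℝ × ℝ≥0∞) × ℝ => p.1.2).mul this
  have hind_mul : ∀ (c : Ω → ℝ≥0∞) ω, A.indicator 1 ω * c ω = A.indicator c ω := by
    intro c ω
    by_cases h : ω ∈ A <;> simp [h]
  calc ∫⁻ ω in A, H (Y ω) (Z ω) ∂P = ∫⁻ ω, K (W ω, Z ω) ∂P := by
        rw [← lintegral_indicator (hm _ hA)]
        exact lintegral_congr fun ω => (hind_mul _ ω).symm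
    _ = ∫⁻ p, K p ∂(P.map fun ω => (W ω, Z ω)) := (lintegral_map hK (hW.prodMk hZ)).symm
    _ = ∫⁻ w, ∫⁻ x, K (w, x) ∂(P.map Z) ∂(P.map W) := by
        rw [hmap, lintegral_prod _ hK.aemeasurable]
    _ = ∫⁻ ω, ∫⁻ x, K (W ω, x) ∂(P.map Z) ∂P := by
        rw [lintegral_map hK.lintegral_prod_right' hW]
    _ = ∫⁻ ω in A, ∫⁻ x, H (Y ω) x ∂(P.map Z) ∂P := by
        rw [← lintegral_indicator (hm _ hA)]
        refine lintegral_congr fun ω => ?_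
        rw [← hind_mul]
        refine lintegral_const_mul _ ?_
        exact hH.comp (f := fun x : ℝ => (Y ω, x)) (by fun_prop)

/-- The σ-algebra generated by the first `n` observations. -/
abbrev pastSigma (X : ℕ+ → Ω → ℝ) (n : ℕ) : MeasurableSpace Ω :=
  ⨆ (j : ℕ+) (_ : (j : ℕ) ≤ n), MeasurableSpace.comap (X j) inferInstance

theorem pastSigma_mono (X : ℕ+ → Ω → ℝ) : Monotone (pastSigma X) := fun _ _ h =>
  iSup_mono fun _ => iSup_mono' fun hj => ⟨hj.trans h, le_rfl⟩

theorem pastSigma_le {mΩ : MeasurableSpace Ω} {X : ℕ+ → Ω → ℝ} (hX : ∀ k, Measurable (X k)) (n : ℕ) :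
    pastSigma X n ≤ mΩ :=
  iSup₂_le fun j _ => (hX j).comap_le

theorem measurable_pastSigma (X : ℕ+ → Ω → ℝ) {j : ℕ+} {n : ℕ} (h : (j : ℕ) ≤ n) :
    Measurable[pastSigma X n] (X j) :=
  Measurable.of_comap_le (le_iSup₂_of_le (f := fun (j : ℕ+) (_ : (j : ℕ) ≤ n) =>
    MeasurableSpace.comap (X j) inferInstance) j h le_rfl)

theorem indep_pastSigma {mΩ : MeasurableSpace Ω} {X : ℕ+ → Ω → ℝ} {P : Measure Ω}
    (hX : ∀ k, Measurable (X k)) (hind : iIndepFun X P) (n : ℕ) :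
    Indep (pastSigma X n) (MeasurableSpace.comap (X n.succPNat) inferInstance) P := by
  have h := indep_iSup_of_disjoint (fun i => (hX i).comap_le) hind.iIndep
    (S := {j : ℕ+ | (j : ℕ) ≤ n}) (T := {n.succPNat}) (by simp)
  simpa using h

variable {X : ℕ+ → Ω → ℝ} {F : ℝ → ℝ → ℝ} {S : ℕ → Ω → ℝ} {s₀ : ℝ}

theorem measurable_chain (hF : Measurable (Function.uncurry F)) (hS0 : ∀ ω, S 0 ω = s₀)
    (hS : ∀ n ω, S (n + 1) ω = F (S n ω) (X n.succPNat ω)) (n : ℕ) :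
    Measurable[pastSigma X n] (S n) := by
  induction n with
  | zero =>
    rw [show S 0 = fun _ => s₀ from funext hS0]
    exact measurable_const
  | succ n ih =>
    rw [show S (n + 1) = fun ω => F (S n ω) (X n.succPNat ω) from funext (hS n)]
    exact hF.comp ((ih.mono (pastSigma_mono X n.le_succ) le_rfl).prodMk
      (measurable_pastSigma X (by simp)))

/-- The event that the recursion has stayed below `a` up to time `n`. -/
def surviving (S : ℕ → Ω → ℝ) (a : ℝ) (n : ℕ) : Set Ω := {ω | ∀ j ≤ n, S j ω < a}

theorem surviving_succ (S : ℕ → Ω → ℝ) (a : ℝ) (n : ℕ) :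
    surviving S a (n + 1) = surviving S a n ∩ {ω | S (n + 1) ω < a} := by
  ext ω
  simp only [surviving, Set.mem_ofPred_eq, Set.mem_inter_iff]
  constructor
  · exact fun h => ⟨fun j hj => h j (by omega), h _ le_rfl⟩
  · rintro ⟨h, h'⟩ j hj
    rcases Nat.lt_or_ge n j with hlt | hge
    · rwa [show j = n + 1 by omega]
    · exact h j hge

theorem measurableSet_surviving_of_forall {m : MeasurableSpace Ω} {a : ℝ} {n : ℕ}
    (h : ∀ j ≤ n, Measurable[m] (S j)) : MeasurableSet[m] (surviving S a n) := by
  have : surviving S a n = ⋂ j ∈ Set.Iic n, {ω | S j ω < a} := by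
    ext ω; simp [surviving]
  rw [this]
  exact MeasurableSet.biInter (Set.to_countable _) fun j hj => h j hj measurableSet_Iio

/-- Induction on the horizon with `k` and `A` free: peel off the term `i = 0`, use the hypothesis at
time `k + 1` (`A` is still a past event), then integrate out the next input. -/
theorem setLIntegral_survivalSum {mΩ : MeasurableSpace Ω} {P : Measure Ω} [IsProbabilityMeasure P]
    (hX : ∀ k, Measurable (X k)) (hind : iIndepFun X P) {μ : Measure ℝ} [IsProbabilityMeasure μ]
    (hF : Measurable (Function.uncurry F)) (hS0 : ∀ ω, S 0 ω = s₀)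
    (hS : ∀ n ω, S (n + 1) ω = F (S n ω) (X n.succPNat ω)) (a : ℝ) (n k : ℕ)
    (hlaw : ∀ j : ℕ+, k < j → P.map (X j) = μ) {A : Set Ω}
    (hA : MeasurableSet[pastSigma X k] A) :
    ∫⁻ ω in A, ∑ i ∈ Finset.range n, (surviving S a (k + i)).indicator 1 ω ∂P
      = ∫⁻ ω in A, (surviving S a k).indicator (fun ω => truncatedExit F a μ n (S k ω)) ω ∂P := by
  have hSm := measurable_chain (X := X) hF hS0 hS
  have hsurv : ∀ k, MeasurableSet[pastSigma X k] (surviving S a k) := fun k =>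
    measurableSet_surviving_of_forall fun j hj => (hSm j).mono (pastSigma_mono X hj) le_rfl
  have hle := pastSigma_le hX
  have hG := fun n => measurable_truncatedExit hF a μ n
  induction n generalizing k A with
  | zero => simp [truncatedExit]
  | succ n ih =>
    set B := A ∩ surviving S a k with hB
    have hBm : MeasurableSet[pastSigma X k] B := hA.inter (hsurv k)
    have hsum : ∀ ω, ∑ i ∈ Finset.range (n + 1), (surviving S a (k + i)).indicator (1 : Ω → ℝ≥0∞) ω
        = (surviving S a k).indicator 1 ω
          + ∑ i ∈ Finset.range n, (surviving S a (k + 1 + i)).indicator 1 ω := by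
      intro ω
      rw [Finset.sum_range_succ', add_comm]
      simp only [add_zero]
      congr 1
      refine Finset.sum_congr rfl fun i _ => ?_
      rw [show k + (i + 1) = k + 1 + i by ring]
    have hmark : ∫⁻ ω in B, truncatedExit F a μ n (S (k + 1) ω) ∂P
        = ∫⁻ ω in B, ∫⁻ x, truncatedExit F a μ n (F (S k ω) x) ∂μ ∂P := by
      have h := setLIntegral_comp_of_indep (P := P) (hle k) (hSm k) (hX k.succPNat)
        (indep_pastSigma hX hind k) (H := fun s x => truncatedExit F a μ n (F s x))
        ((hG n).comp hF) hBm
      rw [hlaw k.succPNat (by simp)] at h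
      rw [← h]
      exact lintegral_congr fun ω => by rw [hS]
    calc ∫⁻ ω in A, ∑ i ∈ Finset.range (n + 1), (surviving S a (k + i)).indicator 1 ω ∂P
        = ∫⁻ ω in A, (surviving S a k).indicator 1 ω ∂P
          + ∫⁻ ω in A, (surviving S a (k + 1)).indicator
              (fun ω => truncatedExit F a μ n (S (k + 1) ω)) ω ∂P := by
          rw [← ih (k + 1) (fun j hj => hlaw j (by omega)) (pastSigma_mono X k.le_succ _ hA),
            ← lintegral_add_left (measurable_one.indicator (hle k _ (hsurv k)))]
          exact lintegral_congr hsum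
      -- The condition at time `k + 1` can be dropped, since the truncated exit time vanishes at or
      -- above `a`.
      _ = ∫⁻ ω in A, (surviving S a k).indicator 1 ω ∂P
          + ∫⁻ ω in A, (surviving S a k).indicator
              (fun ω => truncatedExit F a μ n (S (k + 1) ω)) ω ∂P := by
          congr 1
          refine lintegral_congr fun ω => ?_
          rw [surviving_succ, ← Set.indicator_indicator]
          congr 1
          ext ω'
          by_cases h : S (k + 1) ω' < a
          · simp [h]
          · simp [h, truncatedExit_of_le (not_lt.1 h)]
      _ = ∫⁻ ω in B, 1 ∂P + ∫⁻ ω in B, truncatedExit F a μ n (S (k + 1) ω) ∂P := by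
          rw [setLIntegral_indicator (hle k _ (hsurv k)),
            setLIntegral_indicator (hle k _ (hsurv k)), hB, Set.inter_comm]
          rfl
      _ = ∫⁻ ω in B, (1 + ∫⁻ x, truncatedExit F a μ n (F (S k ω) x) ∂μ) ∂P := by
          rw [hmark, lintegral_add_left measurable_const]
      _ = ∫⁻ ω in B, truncatedExit F a μ (n + 1) (S k ω) ∂P := by
          refine setLIntegral_congr_fun (hle k _ hBm) fun ω hω => ?_
          simp [truncatedExit, hω.2 k le_rfl]
      _ = _ := by rw [setLIntegral_indicator (hle k _ (hsurv k)), hB, Set.inter_comm]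

/-- The conditional expectation of the residual exit time is a function of the current state. -/
theorem condLExp_residual_exit {m mΩ : MeasurableSpace Ω} {P : Measure Ω} [IsProbabilityMeasure P]
    (hX : ∀ k, Measurable (X k)) (hind : iIndepFun X P) {μ : Measure ℝ} [IsProbabilityMeasure μ]
    (hF : Measurable (Function.uncurry F)) (hS0 : ∀ ω, S 0 ω = s₀)
    (hS : ∀ n ω, S (n + 1) ω = F (S n ω) (X n.succPNat ω)) (a : ℝ) (k : ℕ)
    (hlaw : ∀ j : ℕ+, k < j → P.map (X j) = μ) (hm : m ≤ pastSigma X k)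
    (hSm : ∀ j ≤ k, Measurable[m] (S j)) :
    condLExp m P (fun ω => ∑' i, (surviving S a (k + i)).indicator 1 ω) =ᵐ[P]
      (surviving S a k).indicator (fun ω => ⨆ n, truncatedExit F a μ n (S k ω)) := by
  have hle := pastSigma_le hX
  have hSm' := measurable_chain (X := X) hF hS0 hS
  have hsurv : ∀ k, MeasurableSet (surviving S a k) := fun k =>
    measurableSet_surviving_of_forall fun j _ => (hSm' j).mono (hle j) le_rfl
  have hG := fun n => measurable_truncatedExit hF a μ n
  have hGS : ∀ n, Measurable fun ω => truncatedExit F a μ n (S k ω) := fun n =>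
    (hG n).comp ((hSm' k).mono (hle k) le_rfl)
  symm
  -- `m` may be coarser than the full past: the candidate is `m`-measurable because the states up to
  -- `k` are, and `m`-events are past events. Monotone convergence removes the truncation.
  refine ae_eq_condLExp (hm.trans (hle k)) P _ ?_ fun A hA => ?_
  · exact Measurable.indicator (m := m) ((Measurable.iSup hG).comp (hSm k le_rfl))
      (measurableSet_surviving_of_forall hSm)
  · have h1 : ∀ ω, (surviving S a k).indicator (fun ω => ⨆ n, truncatedExit F a μ n (S k ω)) ω
        = ⨆ n, (surviving S a k).indicator (fun ω => truncatedExit F a μ n (S k ω)) ω := by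
      intro ω
      by_cases h : ω ∈ surviving S a k <;> simp [h]
    have h2 : ∀ ω, ∑' i, (surviving S a (k + i)).indicator (1 : Ω → ℝ≥0∞) ω
        = ⨆ n, ∑ i ∈ Finset.range n, (surviving S a (k + i)).indicator 1 ω := fun ω =>
      ENNReal.tsum_eq_iSup_nat
    simp only [h1, h2]
    rw [lintegral_iSup, lintegral_iSup]
    · exact iSup_congr fun n =>
        (setLIntegral_survivalSum hX hind hF hS0 hS a n k hlaw (hm _ hA)).symm
    · exact fun n => Finset.measurable_fun_sum _ fun i _ => measurable_const.indicator (hsurv _)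
    · intro i j hij ω
      exact Finset.sum_le_sum_of_subset (Finset.range_mono hij)
    · exact fun n => (hGS n).indicator (hsurv k)
    · refine monotone_nat_of_le_succ fun n ω => ?_
      exact Set.indicator_le_indicator (truncatedExit_le_succ F a μ n _)

end Chain

/-! ### Densities -/

theorem IsPDF.isProbabilityMeasure {f : ℝ → ℝ} (hf : IsPDF f) :
    IsProbabilityMeasure (densityLaw f) :=
  ⟨by rw [densityLaw, withDensity_apply _ .univ, setLIntegral_univ, hf.lintegral_eq_one]⟩

/-- The censored log-likelihood ratio cannot be almost surely positive before the change. -/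
theorem densityLaw_censoredLLR_nonpos_pos {f₀ f₁ : ℝ → ℝ} (hf₀ : IsPDF f₀) (hf₁ : IsPDF f₁)
    {ψ : ℝ → Bool} (hψ : Measurable ψ) :
    0 < densityLaw f₀ {x | censoredLLR f₀ f₁ ψ (ψ x) x ≤ 0} := by
  have := hf₀.isProbabilityMeasure
  have := hf₁.isProbabilityMeasure
  have hN : MeasurableSet {y | ψ y = false} := hψ (measurableSet_singleton _)
  have hm₀ : Measurable fun x => ENNReal.ofReal (f₀ x) := hf₀.measurable.ennreal_ofReal
  have hm₁ : Measurable fun x => ENNReal.ofReal (f₁ x) := hf₁.measurable.ennreal_ofReal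
  rw [pos_iff_ne_zero]
  intro h0
  have hae : ∀ᵐ x ∂densityLaw f₀, 0 < censoredLLR f₀ f₁ ψ (ψ x) x := by
    rw [ae_iff]
    simpa using h0
  -- The conventions `u / 0 = 0` and `log 0 = 0` exclude `v = 0`.
  have hlt_of_log : ∀ {u v : ℝ}, 0 ≤ u → 0 ≤ v → 0 < Real.log (u / v) → v < u := by
    intro u v hu hv h
    have h1 := (Real.log_pos_iff (div_nonneg hu hv)).1 h
    rcases hv.eq_or_lt with rfl | hv'
    · simp at h1
      linarith
    · exact (one_lt_div hv').1 h1
  have hS : ∀ᵐ x, ψ x = true → ENNReal.ofReal (f₀ x) ≤ ENNReal.ofReal (f₁ x) := by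
    rw [densityLaw, ae_withDensity_iff hm₀] at hae
    filter_upwards [hae] with x hx hψx
    by_cases hz : ENNReal.ofReal (f₀ x) = 0
    · simp [hz]
    · have h := hx hz
      simp only [censoredLLR, hψx, if_true] at h
      exact ENNReal.ofReal_le_ofReal (hlt_of_log (hf₁.nonneg x) (hf₀.nonneg x) h).le
  by_cases hN0 : densityLaw f₀ {y | ψ y = false} = 0
  -- Almost everything is sent, so `f₀ ≤ f₁` a.e.; equal total masses force equality, against the
  -- strict inequality `f₀`-a.e.
  · have hψae : ∀ᵐ x ∂densityLaw f₀, ψ x = true := by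
      rw [ae_iff]
      simpa using hN0
    have hlt : ∀ᵐ x ∂densityLaw f₀, f₀ x < f₁ x := by
      filter_upwards [hae, hψae] with x hx hψx
      simp only [censoredLLR, hψx, if_true] at hx
      exact hlt_of_log (hf₁.nonneg x) (hf₀.nonneg x) hx
    have hle : (fun x => ENNReal.ofReal (f₀ x)) ≤ᵐ[volume] fun x => ENNReal.ofReal (f₁ x) := by
      rw [densityLaw, ae_withDensity_iff hm₀] at hlt
      filter_upwards [hlt] with x hx
      by_cases hz : ENNReal.ofReal (f₀ x) = 0
      · simp [hz]
      · exact ENNReal.ofReal_le_ofReal (hx hz).le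
    have heq := ae_eq_of_ae_le_of_lintegral_le hle (by simp [hf₀.lintegral_eq_one])
      hm₁.aemeasurable (by rw [hf₀.lintegral_eq_one, hf₁.lintegral_eq_one])
    have hfalse : ∀ᵐ x ∂densityLaw f₀, False := by
      have heq' : ∀ᵐ x ∂densityLaw f₀, ENNReal.ofReal (f₀ x) = ENNReal.ofReal (f₁ x) :=
        (withDensity_absolutelyContinuous _ _).ae_le heq
      filter_upwards [hlt, heq'] with x hx hx'
      rw [ENNReal.ofReal_eq_ofReal_iff (hf₀.nonneg x) (hf₁.nonneg x)] at hx'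
      exact hx.ne hx'
    rw [ae_iff] at hfalse
    simp at hfalse
  -- The unsent set gains mass strictly and its complement loses none, contradicting total mass one.
  · have hlt : densityLaw f₀ {y | ψ y = false} < densityLaw f₁ {y | ψ y = false} := by
      obtain ⟨x, hx, hψx⟩ : ∃ x, 0 < censoredLLR f₀ f₁ ψ (ψ x) x ∧ ψ x = false := by
        by_contra! h
        refine hN0 (measure_mono_null (fun x hx => ?_) (ae_iff.1 hae))
        exact fun hpos => h x hpos hx
      simp only [censoredLLR, hψx, Bool.false_eq_true, if_false] at hx
      exact (ENNReal.toReal_lt_toReal (measure_ne_top _ _) (measure_ne_top _ _)).1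
        (hlt_of_log measureReal_nonneg measureReal_nonneg hx)
    have hle : densityLaw f₀ {y | ψ y = false}ᶜ ≤ densityLaw f₁ {y | ψ y = false}ᶜ := by
      rw [densityLaw, densityLaw, withDensity_apply _ hN.compl, withDensity_apply _ hN.compl]
      refine setLIntegral_mono_ae hm₁.aemeasurable ?_
      filter_upwards [hS] with x hx hxN
      exact hx (by simpa using hxN)
    have hsum := ENNReal.add_lt_add_of_lt_of_le (measure_ne_top _ _) hlt hle
    rw [measure_add_measure_compl hN, measure_add_measure_compl hN] at hsum
    simp at hsum

/-! ### The CuSum-AC recursion -/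

section Recursion

variable {f₀ f₁ : ℝ → ℝ} {ψhi ψlo : ℝ → Bool} {a₁ : ℝ}

/-- The update of the statistic as a function of its current value `s` and of the information
`(γ, γ * x)` received. -/
noncomputable def infoStep (f₀ f₁ : ℝ → ℝ) (ψhi ψlo : ℝ → Bool) (a₁ : ℝ) (p : ℝ × Bool × ℝ) : ℝ :=
  let q := max 0 (p.1 + censoredLLR f₀ f₁ (strategyAt ψhi ψlo a₁ p.1) p.2.1 p.2.2)
  if p.1 < a₁ ∧ a₁ ≤ q then a₁ else q

theorem step_eq_infoStep (s x : ℝ) :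
    step f₀ f₁ ψhi ψlo a₁ s x = infoStep f₀ f₁ ψhi ψlo a₁ (s, strategyAt ψhi ψlo a₁ s x, x) :=
  rfl

/-- An unsent observation enters only through the event that it is unsent, so the placeholder `0` in
`received` is harmless. -/
theorem infoStep_congr (s x y : ℝ) (γ : Bool) (h : γ = true → x = y) :
    infoStep f₀ f₁ ψhi ψlo a₁ (s, γ, x) = infoStep f₀ f₁ ψhi ψlo a₁ (s, γ, y) := by
  cases γ
  · simp [infoStep, censoredLLR]
  · rw [h rfl]

theorem measurable_infoStep (hf₀ : Measurable f₀) (hf₁ : Measurable f₁) :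
    Measurable (infoStep f₀ f₁ ψhi ψlo a₁) := by
  have hlog : Measurable fun p : ℝ × Bool × ℝ => Real.log (f₁ p.2.2 / f₀ p.2.2) :=
    Real.measurable_log.comp ((hf₁.comp measurable_snd.snd).div (hf₀.comp measurable_snd.snd))
  have hγ : MeasurableSet {p : ℝ × Bool × ℝ | p.2.1 = true} :=
    (measurable_fst.comp measurable_snd) (measurableSet_singleton true)
  have hs : MeasurableSet {p : ℝ × Bool × ℝ | a₁ ≤ p.1} :=
    measurableSet_le measurable_const measurable_fst
  have hL : Measurable fun p : ℝ × Bool × ℝ =>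
      censoredLLR f₀ f₁ (strategyAt ψhi ψlo a₁ p.1) p.2.1 p.2.2 := by
    have : (fun p : ℝ × Bool × ℝ => censoredLLR f₀ f₁ (strategyAt ψhi ψlo a₁ p.1) p.2.1 p.2.2)
        = fun p => if a₁ ≤ p.1 then censoredLLR f₀ f₁ ψhi p.2.1 p.2.2
            else censoredLLR f₀ f₁ ψlo p.2.1 p.2.2 := by
      ext p
      by_cases h : a₁ ≤ p.1 <;> simp [strategyAt, h]
    rw [this]
    exact Measurable.ite hs (Measurable.ite hγ hlog measurable_const)
      (Measurable.ite hγ hlog measurable_const)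
  have hq := measurable_const (a := (0 : ℝ)).max (measurable_fst.add hL)
  exact Measurable.ite ((measurableSet_lt measurable_fst measurable_const).inter
    (measurableSet_le measurable_const hq)) measurable_const hq

theorem measurable_strategyAt (hhi : Measurable ψhi) (hlo : Measurable ψlo) :
    Measurable fun p : ℝ × ℝ => strategyAt ψhi ψlo a₁ p.1 p.2 := by
  have : (fun p : ℝ × ℝ => strategyAt ψhi ψlo a₁ p.1 p.2)
      = fun p => if a₁ ≤ p.1 then ψhi p.2 else ψlo p.2 := by
    ext p
    by_cases h : a₁ ≤ p.1 <;> simp [strategyAt, h]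
  rw [this]
  exact Measurable.ite (measurableSet_le measurable_const measurable_fst)
    (hhi.comp measurable_snd) (hlo.comp measurable_snd)

theorem measurable_step (hf₀ : Measurable f₀) (hf₁ : Measurable f₁) (hhi : Measurable ψhi)
    (hlo : Measurable ψlo) : Measurable (Function.uncurry (step f₀ f₁ ψhi ψlo a₁)) :=
  (measurable_infoStep hf₀ hf₁).comp
    (measurable_fst.prodMk ((measurable_strategyAt hhi hlo).prodMk measurable_snd))

theorem step_le_of_lt {s : ℝ} (hs : s < a₁) (x : ℝ) : step f₀ f₁ ψhi ψlo a₁ s x ≤ a₁ := by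
  unfold step
  split_ifs with h
  · exact le_rfl
  · exact (not_le.1 fun h' => h ⟨hs, h'⟩).le

theorem step_mono_of_lt {s t : ℝ} (hst : s ≤ t) (ht : t < a₁) (x : ℝ) :
    step f₀ f₁ ψhi ψlo a₁ s x ≤ step f₀ f₁ ψhi ψlo a₁ t x := by
  have hs := hst.trans_lt ht
  have hpre : preStep f₀ f₁ ψhi ψlo a₁ s x ≤ preStep f₀ f₁ ψhi ψlo a₁ t x := by
    simp only [preStep, strategyAt, hs.not_ge, ht.not_ge, if_false]
    gcongr
  simp only [step, hs, ht, true_and]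
  split_ifs with h1 h2 h2
  · exact le_rfl
  · exact absurd (h1.trans hpre) h2
  · exact (not_le.1 h1).le
  · exact hpre

theorem step_mono_of_ge {s t : ℝ} (hs : a₁ ≤ s) (hst : s ≤ t) (x : ℝ) :
    step f₀ f₁ ψhi ψlo a₁ s x ≤ step f₀ f₁ ψhi ψlo a₁ t x := by
  have ht := hs.trans hst
  simp only [step, preStep, strategyAt, hs, ht, hs.not_gt, ht.not_gt, if_true, false_and, if_false]
  gcongr

theorem step_nonneg {s : ℝ} (hs : 0 ≤ s) (x : ℝ) : 0 ≤ step f₀ f₁ ψhi ψlo a₁ s x := by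
  unfold step
  split_ifs with h
  -- A reset happens only from `s < a₁`, so `a₁` is positive here even though its sign is not
  -- assumed.
  · exact hs.trans h.1.le
  · exact le_max_left _ _

theorem step_zero_of_censoredLLR_nonpos {x : ℝ}
    (h : censoredLLR f₀ f₁ (strategyAt ψhi ψlo a₁ 0) (strategyAt ψhi ψlo a₁ 0 x) x ≤ 0) :
    step f₀ f₁ ψhi ψlo a₁ 0 x = 0 := by
  have hpre : preStep f₀ f₁ ψhi ψlo a₁ 0 x = 0 := by
    rw [preStep, zero_add]
    exact max_eq_left h
  rw [step, hpre, if_neg]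
  rintro ⟨h1, h2⟩
  exact absurd h1 h2.not_gt

theorem statistic_nonneg (x : ℕ+ → ℝ) (n : ℕ) : 0 ≤ statistic f₀ f₁ ψhi ψlo a₁ x n := by
  induction n with
  | zero => exact le_rfl
  | succ n ih => exact step_nonneg ih _

theorem statistic_eq_zero {x : ℕ+ → ℝ} {n : ℕ} (h : ∀ j : ℕ+, (j : ℕ) ≤ n →
    censoredLLR f₀ f₁ (strategyAt ψhi ψlo a₁ 0) (strategyAt ψhi ψlo a₁ 0 (x j)) (x j) ≤ 0) :
    statistic f₀ f₁ ψhi ψlo a₁ x n = 0 := by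
  induction n with
  | zero => rfl
  | succ n ih =>
    rw [statistic, ih fun j hj => h j (by omega)]
    exact step_zero_of_censoredLLR_nonpos (h _ (by simp))

theorem lt_stoppingTime_iff {a : ℝ} (ha : 0 < a) (x : ℕ+ → ℝ) (n : ℕ) :
    (n : ℕ∞) < stoppingTime f₀ f₁ ψhi ψlo a₁ a x ↔
      ∀ j ≤ n, statistic f₀ f₁ ψhi ψlo a₁ x j < a := by
  rw [← Order.add_one_le_iff_of_not_isMax (by simp), stoppingTime, le_iInf₂_iff]
  constructor
  · intro h j hj
    rcases Nat.eq_zero_or_pos j with rfl | hpos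
    -- The stopping time ignores time `0`; there the statistic is `0 < a`.
    · exact ha
    · by_contra! hge
      have : n + 1 ≤ j := by exact_mod_cast h ⟨j, hpos⟩ hge
      omega
  · intro h k hk
    by_contra! hlt
    have : (k : ℕ) < n + 1 := by exact_mod_cast hlt
    exact absurd hk (h k (by omega)).not_ge

/-- Counting the integers in `[k, t)` writes the delay as a sum of survival indicators. -/
theorem enat_sub_eq_tsum (t : ℕ∞) (k : ℕ) :
    ((t - k : ℕ∞) : ℝ≥0∞) = ∑' i : ℕ, if ((k + i : ℕ) : ℕ∞) < t then 1 else 0 := by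
  induction t using ENat.recTopCoe with
  | top =>
    have : ∀ i : ℕ, ((k + i : ℕ) : ℕ∞) < ⊤ := fun i => ENat.natCast_lt_top _
    simp only [this, if_true, ENNReal.tsum_const_eq_top_of_ne_zero one_ne_zero]
    rw [ENat.top_sub_natCast, ENat.toENNReal_top]
  | coe t =>
    simp only [Nat.cast_lt]
    rw [tsum_eq_sum (s := Finset.range (t - k))]
    · rw [Finset.sum_congr rfl fun i hi => if_pos (by rw [Finset.mem_range] at hi; omega)]
      rw [← ENat.natCast_sub]
      simp
    · intro i hi
      rw [Finset.mem_range] at hi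
      rw [if_neg (by omega)]

end Recursion

/-! ### Received information versus the full past -/

section Information

variable {Ω : Type*} {f₀ f₁ : ℝ → ℝ} {ψhi ψlo : ℝ → Bool} {a₁ : ℝ} {X : ℕ+ → Ω → ℝ}
  {Ψ : ℕ+ → Ω → ℝ → Bool}

theorem measurable_infoSigma (X : ℕ+ → Ω → ℝ) (Ψ : ℕ+ → Ω → ℝ → Bool) {j : ℕ+} {n : ℕ}
    (h : (j : ℕ) ≤ n) :
    Measurable[infoSigma X Ψ n] fun ω => (sent X Ψ j ω, received X Ψ j ω) :=
  Measurable.of_comap_le (le_iSup₂_of_le (f := fun (j : ℕ+) (_ : (j : ℕ) ≤ n) =>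
    MeasurableSpace.comap (fun ω => (sent X Ψ j ω, received X Ψ j ω)) inferInstance) j h le_rfl)

theorem infoSigma_mono (X : ℕ+ → Ω → ℝ) (Ψ : ℕ+ → Ω → ℝ → Bool) : Monotone (infoSigma X Ψ) :=
  fun _ _ h => iSup_mono fun _ => iSup_mono' fun hj => ⟨hj.trans h, le_rfl⟩

theorem measurable_statistic_infoSigma (hf₀ : Measurable f₀) (hf₁ : Measurable f₁)
    (hΨ : Ψ = fun k ω => policy f₀ f₁ ψhi ψlo a₁ (fun j => X j ω) k) (n : ℕ) :
    Measurable[infoSigma X Ψ n] fun ω => statistic f₀ f₁ ψhi ψlo a₁ (fun j => X j ω) n := by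
  induction n with
  | zero => exact measurable_const
  | succ n ih =>
    have heq : (fun ω => statistic f₀ f₁ ψhi ψlo a₁ (fun j => X j ω) (n + 1))
        = fun ω => infoStep f₀ f₁ ψhi ψlo a₁ (statistic f₀ f₁ ψhi ψlo a₁ (fun j => X j ω) n,
            sent X Ψ n.succPNat ω, received X Ψ n.succPNat ω) := by
      ext ω
      have hsent : sent X Ψ n.succPNat ω = strategyAt ψhi ψlo a₁
          (statistic f₀ f₁ ψhi ψlo a₁ (fun j => X j ω) n) (X n.succPNat ω) := by
        rw [hΨ]; rfl
      rw [statistic, step_eq_infoStep, ← hsent]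
      exact infoStep_congr _ _ _ _ fun h => by simp [received, h]
    rw [heq]
    exact (measurable_infoStep hf₀ hf₁).comp
      ((ih.mono (infoSigma_mono X Ψ n.le_succ) le_rfl).prodMk
        (measurable_infoSigma X Ψ (by simp)))

/-- The strategy at time `j` depends on the statistic at `j - 1`, hence only on earlier
observations. -/
theorem infoSigma_le_pastSigma (hf₀ : Measurable f₀) (hf₁ : Measurable f₁)
    (hhi : Measurable ψhi) (hlo : Measurable ψlo)
    (hΨ : Ψ = fun k ω => policy f₀ f₁ ψhi ψlo a₁ (fun j => X j ω) k) (n : ℕ) :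
    infoSigma X Ψ n ≤ pastSigma X n := by
  refine iSup₂_le fun j hj => ?_
  rw [← measurable_iff_comap_le]
  have hXj : Measurable[pastSigma X n] (X j) := measurable_pastSigma X hj
  have hstat : Measurable[pastSigma X n]
      fun ω => statistic f₀ f₁ ψhi ψlo a₁ (fun j => X j ω) ((j : ℕ) - 1) :=
    (measurable_chain (X := X) (measurable_step hf₀ hf₁ hhi hlo) (s₀ := 0)
      (S := fun n ω => statistic f₀ f₁ ψhi ψlo a₁ (fun j => X j ω) n)
      (fun _ => rfl) (fun _ _ => rfl) _).mono (pastSigma_mono X (by omega)) le_rfl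
  have hsent : Measurable[pastSigma X n] (sent X Ψ j) := by
    rw [hΨ]
    exact (measurable_strategyAt hhi hlo).comp (hstat.prodMk hXj)
  exact hsent.prodMk (Measurable.ite (hsent (measurableSet_singleton true)) hXj measurable_const)

end Information

/-- The worst conditional delay of CuSum-AC is the expected delay from the initial state,
whatever the change time. -/
theorem worstDelayAt_eq {Ω : Type*} [MeasurableSpace Ω] {f₀ f₁ : ℝ → ℝ} (hf₀ : IsPDF f₀)
    (hf₁ : IsPDF f₁) {X : ℕ+ → Ω → ℝ} {P : ℕ+ → Measure Ω} [∀ ν, IsProbabilityMeasure (P ν)]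
    (hX : IsChangePointModel f₀ f₁ X P) {a₁ a : ℝ} (ha₁ : a₁ < a) (ha : 0 < a)
    {ψhi ψlo : ℝ → Bool} (hhi : Measurable ψhi) (hlo : Measurable ψlo)
    {Ψ : ℕ+ → Ω → ℝ → Bool} (hΨ : Ψ = fun k ω => policy f₀ f₁ ψhi ψlo a₁ (fun j => X j ω) k)
    {T : Ω → ℕ∞} (hT : T = fun ω => stoppingTime f₀ f₁ ψhi ψlo a₁ a (fun j => X j ω)) (ν : ℕ+) :
    worstDelayAt P X Ψ T ν
      = ⨆ n, truncatedExit (step f₀ f₁ ψhi ψlo a₁) a (densityLaw f₁) n 0 := by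
  have := hf₁.isProbabilityMeasure
  set F := step f₀ f₁ ψhi ψlo a₁ with hFdef
  set S : ℕ → Ω → ℝ := fun n ω => statistic f₀ f₁ ψhi ψlo a₁ (fun j => X j ω) n with hSdef
  set k : ℕ := (ν : ℕ) - 1 with hk
  have hνk : (ν : ℕ) = k + 1 := by have := ν.pos; omega
  have hF : Measurable (Function.uncurry F) :=
    measurable_step hf₀.measurable hf₁.measurable hhi hlo
  have hdelay : (fun ω => ((T ω + 1 - ((ν : ℕ) : ℕ∞) : ℕ∞) : ℝ≥0∞))
      = fun ω => ∑' i, (surviving S a (k + i)).indicator 1 ω := by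
    ext ω
    have hsub : T ω + 1 - ((ν : ℕ) : ℕ∞) = T ω - (k : ℕ∞) := by
      rw [hνk, Nat.cast_add, Nat.cast_one, add_comm (k : ℕ∞), ← tsub_tsub,
        (ENat.addLECancellable_of_ne_top ENat.one_ne_top).add_tsub_cancel_right]
    rw [hsub, enat_sub_eq_tsum]
    refine tsum_congr fun i => ?_
    have : ((k + i : ℕ) : ℕ∞) < T ω ↔ ω ∈ surviving S a (k + i) := by
      rw [hT]
      exact lt_stoppingTime_iff ha _ _
    by_cases h : ω ∈ surviving S a (k + i)
    · rw [if_pos (this.2 h), Set.indicator_of_mem h, Pi.one_apply]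
    · rw [if_neg (mt this.1 h), Set.indicator_of_notMem h]
  have hcond := condLExp_residual_exit (P := P ν) (μ := densityLaw f₁) hX.measurable (hX.indep ν)
    hF (S := S) (s₀ := 0) (fun _ => rfl) (fun _ _ => rfl) a k
    (fun j hj => hX.law_post ν j (by rw [← PNat.coe_le_coe]; omega))
    (infoSigma_le_pastSigma hf₀.measurable hf₁.measurable hhi hlo hΨ k)
    (fun j hj => (measurable_statistic_infoSigma hf₀.measurable hf₁.measurable hΨ j).mono
      (infoSigma_mono X Ψ hj) le_rfl)
  rw [worstDelayAt, hdelay, essSup_congr_ae hcond]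
  apply le_antisymm
  -- Upper bound: the state is at least `0` and the exit time is antitone.
  · refine essSup_le_of_ae_le _ (Filter.Eventually.of_forall fun ω => ?_)
    refine Set.indicator_apply_le' (fun _ => iSup_mono fun n => ?_) fun _ => zero_le
    exact antitone_truncatedExit ha₁ (fun _ _ => step_mono_of_lt) (fun _ _ => step_mono_of_ge)
      (fun _ => step_le_of_lt) n (statistic_nonneg _ _)
  · set C : Set ℝ := {x | censoredLLR f₀ f₁ (strategyAt ψhi ψlo a₁ 0)
      (strategyAt ψhi ψlo a₁ 0 x) x ≤ 0} with hC
    have hstrat : Measurable (strategyAt ψhi ψlo a₁ 0) := by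
      unfold strategyAt
      split_ifs <;> assumption
    have hCm : MeasurableSet C := by
      refine measurableSet_le ?_ measurable_const
      exact Measurable.ite (hstrat (measurableSet_singleton true))
        (Real.measurable_log.comp (hf₁.measurable.div hf₀.measurable)) measurable_const
    have hCpos : densityLaw f₀ C ≠ 0 :=
      (densityLaw_censoredLLR_nonpos_pos hf₀ hf₁ hstrat).ne'
    -- On this event every pre-change increment from `0` is nonpositive, so the statistic is still
    -- `0` at `ν - 1` and the conditional delay equals the bound. For `ν = 1` the intersection is
    -- the whole space.
    have hpos : P ν (⋂ j ∈ Finset.Iio ν, X j ⁻¹' C) ≠ 0 := by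
      rw [(hX.indep ν).measure_inter_preimage_eq_mul _ (fun _ _ => hCm), Finset.prod_ne_zero_iff]
      intro j hj
      rw [← Measure.map_apply (hX.measurable j) hCm, hX.law_pre ν j (Finset.mem_Iio.1 hj)]
      exact hCpos
    by_contra! hlt
    refine hpos (measure_mono_null (fun ω hω => ?_) (ae_iff.1 (ae_lt_of_essSup_lt hlt)))
    have hzero : ∀ j ≤ k, S j ω = 0 := fun j hj => statistic_eq_zero fun i hi =>
      Set.mem_iInter₂.1 hω i (Finset.mem_Iio.2 (by rw [← PNat.coe_lt_coe]; omega))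
    have hmem : ω ∈ surviving S a k := fun j hj => by rw [hzero j hj]; exact ha
    rw [Set.mem_ofPred_eq, Set.indicator_of_mem hmem, hzero k le_rfl]
    exact lt_irrefl _

end CuSumAC

theorem theorem1 {Ω : Type*} [MeasurableSpace Ω]
    (f₀ f₁ : ℝ → ℝ) (hf₀ : CuSumAC.IsPDF f₀) (hf₁ : CuSumAC.IsPDF f₁)
    (hKL₁₀_pos : 0 < InformationTheory.klDiv (CuSumAC.densityLaw f₁) (CuSumAC.densityLaw f₀))
    (hKL₁₀_fin : InformationTheory.klDiv (CuSumAC.densityLaw f₁) (CuSumAC.densityLaw f₀) < ∞)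
    (hKL₀₁_pos : 0 < InformationTheory.klDiv (CuSumAC.densityLaw f₀) (CuSumAC.densityLaw f₁))
    (hKL₀₁_fin : InformationTheory.klDiv (CuSumAC.densityLaw f₀) (CuSumAC.densityLaw f₁) < ∞)
    (X : ℕ+ → Ω → ℝ) (P : ℕ+ → Measure Ω) [∀ ν, IsProbabilityMeasure (P ν)]
    (hX : CuSumAC.IsChangePointModel f₀ f₁ X P)
    (a₁ a ε₁ : ℝ) (ha₁ : a₁ < a) (ha : 0 < a) (hε₁ : 0 < ε₁) (hε₁' : ε₁ ≤ 1)
    (ψhi ψlo : ℝ → Bool)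
    (hψhi : CuSumAC.IsOptimalCensoring f₀ f₁ 1 ψhi)
    (hψlo : CuSumAC.IsOptimalCensoring f₀ f₁ ε₁ ψlo)
    (Ψ : ℕ+ → Ω → ℝ → Bool)
    (hΨ : Ψ = fun k ω => CuSumAC.policy f₀ f₁ ψhi ψlo a₁ (fun j => X j ω) k)
    (T : Ω → ℕ∞)
    (hT : T = fun ω => CuSumAC.stoppingTime f₀ f₁ ψhi ψlo a₁ a (fun j => X j ω)) :
    ∀ ν : ℕ+, CuSumAC.lordenDelay P X Ψ T = CuSumAC.worstDelayAt P X Ψ T ν := by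
  intro ν
  have h := CuSumAC.worstDelayAt_eq hf₀ hf₁ hX ha₁ ha hψhi.1.1 hψlo.1.1 hΨ hT
  simp [CuSumAC.lordenDelay, h]
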